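/- Let $n\ge 0$ be an integer, let $r,\mu>0$, and let $\mathcal Z\subseteq\mathbb Z^n\setminus\{0\}$. Let $b_k>0$ $(k\in\mathcal Z)$ be arbitrary positive weights and put $b_{\mathcal Z}:=\sum_{k\in\mathcal Z}b_k\in[0,\infty]$ (the claim has content only when $b_{\mathcal Z}<\infty$). Let $|\cdot|$ denote the Euclidean norm on $\mathbb R^n$ and on $\mathbb C^n$. For every $k\in\mathcal Z$ let $f_k$ be a holomorphic function on the complex ball $\{y\in\mathbb C^n:\ |y|<r\}$ with $$\sup_{|y|<r}|f_k(y)|\le 1\qquad\text{and}\qquad |f_k(0)|\ge\hat\delta_k>0 .$$ Then, for all $y\in\mathbb R^n$ with $|y|<\frac{r}{2e}$, except at most for a set of $n$-dimensional Lebesgue measure at most $$\frac12\,\operatorname{meas}_{n-1}(S^{n-1})\; b_{\mathcal Z}\,\Big(\frac{r}{2e}\Big)^{n}\mu ,$$ one has, with $\log$ the natural logarithm, $$|f_k(y)|\ \ge\ \hat\delta_k\Big(\frac{\mu\, b_k}{30\,e^3}\Big)^{\log (1/\hat\delta_k)}\qquad\text{for all }k\in\mathcal Z\text{ simultaneously.}$$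 Here $S^{n-1}=\{y\in\mathbb R^n: |y|=1\}$ and $\operatorname{meas}_{n-1}$ is its surface measure (for $n=1$, the counting measure on $\{\pm1\}$; for $n=0$ the set $\mathcal Z$ is empty and the claim is trivial, the displayed bound being $0$). -/

import Mathlib

open MeasureTheory

noncomputable section

/-- The inclusion `ℝⁿ ⊆ ℂⁿ` (both with the Euclidean norm). -/
def realToComplex {n : ℕ} (y : EuclideanSpace ℝ (Fin n)) : EuclideanSpace ℂ (Fin n) :=
  WithLp.toLp 2 (fun i => ((y i : ℝ) : ℂ))

/-- The total `(n-1)`-dimensional surface measure of the unit sphere `S^{n-1}` of `ℝⁿ`. -/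
def sphereArea (n : ℕ) : ENNReal :=
  (volume : Measure (EuclideanSpace ℝ (Fin n))).toSphere Set.univ

/-- The sum of the weights `b k` over `k ∈ Z`, for nonnegative weights, as an element of `[0, ∞]`. -/
def weightSum {n : ℕ} (b : (Fin n → ℤ) → ℝ) (Z : Set (Fin n → ℤ)) : ENNReal :=
  ∑' k : Z, ENNReal.ofReal (b k)

end

/-! Restricting `f k` to a complex line through the origin reduces everything to one function `g` on
the unit disc with `‖g‖ ≤ 1`. Dividing out a zero `a` with `‖a‖ < 1/e` by a Blaschke factor
multiplies `‖g 0‖` by at least `e`, so at most `N ≤ log (1/‖g 0‖)` divisions occur. The zero-free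
quotient is bounded below on half the radius by the cube of its value at `0`, by Borel–Carathéodory.
Hence `‖g‖` dominates a constant times a monic polynomial of degree `N`
(`exists_monic_lower_bound`). A monic polynomial of degree `N` is below `h ^ N` on a real set of
length at most `2 * e * h`, by Lagrange interpolation at separated points
(`volume_le_of_norm_eval_lt`). This bounds the bad set on every ray; polar coordinates bound it in
the ball, and a union bound with `β = μ * b k` sums over `k`. -/

/-! ### Zero-free bounded functions on a disc. -/

/-- Write `g = g 0 * exp F` with `F 0 = 0`. Then `re F ≤ M := -log ‖g 0‖`, so Borel–Carathéodory
gives `‖F‖ ≤ 2 * M` at half the radius, and `‖g 0‖ * exp (-2 * M) = ‖g 0‖ ^ 3`. -/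
theorem norm_pow_three_le_of_ne_zero {g : ℂ → ℂ} {T : ℝ} (hT : 0 < T)
    (hg : DifferentiableOn ℂ g (Metric.ball 0 T)) (hg1 : ∀ z ∈ Metric.ball (0 : ℂ) T, ‖g z‖ ≤ 1)
    (hg0 : ∀ z ∈ Metric.ball (0 : ℂ) T, g z ≠ 0) {z : ℂ} (hz : 2 * ‖z‖ ≤ T) :
    ‖g 0‖ ^ 3 ≤ ‖g z‖ := by
  have hz' : z ∈ Metric.ball (0 : ℂ) T := by
    rw [mem_ball_zero_iff]; linarith [norm_nonneg z]
  have h0 : (0 : ℂ) ∈ Metric.ball (0 : ℂ) T := Metric.mem_ball_self hT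
  have hd : DifferentiableOn ℂ (fun z => deriv g z / g z) (Metric.ball 0 T) :=
    (hg.deriv Metric.isOpen_ball).div hg hg0
  obtain ⟨F, hF0, hF⟩ := (hd.isExactOn_ball).with_val_at 0 0
  have hFd : DifferentiableOn ℂ F (Metric.ball 0 T) := fun w hw =>
    (hF w hw).differentiableAt.differentiableWithinAt
  have key : ∀ w ∈ Metric.ball (0 : ℂ) T, g w = g 0 * Complex.exp (F w) := by
    intro w hw
    have hder : ∀ w ∈ Metric.ball (0 : ℂ) T,
        HasDerivWithinAt (fun w => g w * Complex.exp (-F w)) 0 (Metric.ball 0 T) w := by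
      intro w hw
      have h1 := (hg.differentiableAt (Metric.isOpen_ball.mem_nhds hw)).hasDerivAt
      have h2 := h1.mul (hF w hw).neg.cexp
      refine (h2.congr_deriv ?_).hasDerivWithinAt
      have := hg0 w hw
      field_simp
      ring
    have := (convex_ball (0 : ℂ) T).is_const_of_fderivWithin_eq_zero (𝕜 := ℂ)
      (fun w hw => (hder w hw).differentiableWithinAt)
      (fun w hw => by
        have := (hder w hw).hasFDerivWithinAt.fderivWithin
          (Metric.isOpen_ball.uniqueDiffWithinAt hw)
        rw [this]; ext; simp) hw h0
    simp only [hF0, neg_zero, Complex.exp_zero, mul_one] at this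
    rw [← this, mul_assoc, ← Complex.exp_add]
    simp
  have hg0' : 0 < ‖g 0‖ := norm_pos_iff.2 (hg0 0 h0)
  have bound : ∀ M : ℝ, 0 < M → -Real.log ‖g 0‖ ≤ M → ‖g 0‖ * Real.exp (-(2 * M)) ≤ ‖g z‖ := by
    intro M hM hM'
    have hre : Set.MapsTo F (Metric.ball 0 T) {z | z.re ≤ M} := by
      intro w hw
      have h1 := hg1 w hw
      rw [key w hw, norm_mul, Complex.norm_exp] at h1
      have h2 := Real.log_le_log (by positivity) h1
      rw [Real.log_mul hg0'.ne' (Real.exp_pos _).ne', Real.log_exp, Real.log_one] at h2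
      simp only [Set.mem_ofPred_eq]
      linarith
    have h3 := Complex.borelCaratheodory_zero hM hFd hre hT hz' hF0
    have h4 : 2 * M * ‖z‖ / (T - ‖z‖) ≤ 2 * M := by
      rw [div_le_iff₀ (by linarith [norm_nonneg z])]
      nlinarith
    rw [key z hz', norm_mul, Complex.norm_exp]
    gcongr
    linarith [Complex.abs_re_le_norm (F z), neg_abs_le (F z).re]
  have hlog : Real.log ‖g 0‖ ≤ 0 := Real.log_nonpos hg0'.le (hg1 0 h0)
  -- Borel–Carathéodory needs `0 < M`, but `-log ‖g 0‖` may vanish; hence the limit from the right.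
  have hcont : Filter.Tendsto (fun M : ℝ => ‖g 0‖ * Real.exp (-(2 * M)))
      (nhdsWithin (-Real.log ‖g 0‖) (Set.Ioi (-Real.log ‖g 0‖)))
      (nhds (‖g 0‖ * Real.exp (-(2 * (-Real.log ‖g 0‖))))) :=
    ((by fun_prop : Continuous fun M : ℝ => ‖g 0‖ * Real.exp (-(2 * M))).tendsto _).mono_left
      nhdsWithin_le_nhds
  have := le_of_tendsto hcont (b := ‖g z‖) (by
    filter_upwards [self_mem_nhdsWithin] with M hM
    have hM : -Real.log ‖g 0‖ < M := hM
    exact bound M (by linarith) hM.le)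
  rw [show -(2 * -Real.log ‖g 0‖) = Real.log ‖g 0‖ + Real.log ‖g 0‖ by ring, Real.exp_add,
    Real.exp_log hg0'] at this
  linarith [pow_succ ‖g 0‖ 2, sq ‖g 0‖, mul_comm (‖g 0‖ * ‖g 0‖) ‖g 0‖]

/-! ### Blaschke factors and Schwarz–Pick. -/

theorem normSq_one_sub_conj_mul_sub_normSq_sub (a z : ℂ) :
    ‖1 - (starRingEnd ℂ) a * z‖ ^ 2 - ‖z - a‖ ^ 2 = (1 - ‖a‖ ^ 2) * (1 - ‖z‖ ^ 2) := by
  simp only [Complex.sq_norm, Complex.normSq_apply]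
  simp
  ring

theorem norm_sub_lt_norm_one_sub_conj_mul {a z : ℂ} (ha : ‖a‖ < 1) (hz : ‖z‖ < 1) :
    ‖z - a‖ < ‖1 - (starRingEnd ℂ) a * z‖ := by
  have h := normSq_one_sub_conj_mul_sub_normSq_sub a z
  have h1 : 0 < (1 - ‖a‖ ^ 2) * (1 - ‖z‖ ^ 2) := by
    apply mul_pos <;> nlinarith [norm_nonneg a, norm_nonneg z]
  exact lt_of_pow_lt_pow_left₀ 2 (norm_nonneg _) (by linarith)

theorem one_sub_conj_mul_ne_zero {a z : ℂ} (ha : ‖a‖ < 1) (hz : ‖z‖ < 1) :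
    1 - (starRingEnd ℂ) a * z ≠ 0 :=
  norm_pos_iff.1 ((norm_nonneg _).trans_lt (norm_sub_lt_norm_one_sub_conj_mul ha hz))

/-- The Schwarz–Pick bound at a zero of a bounded holomorphic function on the unit disc. -/
theorem norm_mul_le_norm_sub_of_eq_zero {g : ℂ → ℂ} (hg : DifferentiableOn ℂ g (Metric.ball 0 1))
    (hg1 : ∀ z ∈ Metric.ball (0 : ℂ) 1, ‖g z‖ ≤ 1) {a z : ℂ} (ha : ‖a‖ < 1) (hga : g a = 0)
    (hz : ‖z‖ < 1) : ‖g z‖ * ‖1 - (starRingEnd ℂ) a * z‖ ≤ ‖z - a‖ := by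
  have hna : ‖-a‖ < 1 := by rwa [norm_neg]
  set φ : ℂ → ℂ := fun w => (w - -a) / (1 - (starRingEnd ℂ) (-a) * w) with hφ
  have hmaps : ∀ {b w : ℂ}, ‖b‖ < 1 → ‖w‖ < 1 → ‖(w - b) / (1 - (starRingEnd ℂ) b * w)‖ < 1 := by
    intro b w hb hw
    rw [norm_div, div_lt_one (norm_pos_iff.2 (one_sub_conj_mul_ne_zero hb hw))]
    exact norm_sub_lt_norm_one_sub_conj_mul hb hw
  have hφd : DifferentiableOn ℂ φ (Metric.ball 0 1) := by
    intro w hw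
    have := one_sub_conj_mul_ne_zero hna (mem_ball_zero_iff.1 hw)
    exact DifferentiableWithinAt.fun_div (by fun_prop) (by fun_prop) this
  have hφm : Set.MapsTo φ (Metric.ball 0 1) (Metric.ball 0 1) := fun w hw =>
    mem_ball_zero_iff.2 (hmaps hna (mem_ball_zero_iff.1 hw))
  have hne := one_sub_conj_mul_ne_zero ha hz
  have hw := hmaps ha hz
  have hφw : φ ((z - a) / (1 - (starRingEnd ℂ) a * z)) = z := by
    have h1 := one_sub_conj_mul_ne_zero hna hw
    simp only [hφ]
    rw [div_eq_iff h1]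
    have : 1 - z * (starRingEnd ℂ) a ≠ 0 := by rwa [mul_comm z]
    simp only [map_neg]
    field_simp
    ring
  have h := Complex.norm_le_norm_of_mapsTo_ball (f := g ∘ φ) (R := 1)
    (z := (z - a) / (1 - (starRingEnd ℂ) a * z)) (hg.comp hφd hφm)
    (fun w hw => by simpa using hg1 _ (hφm hw)) (by simp [hφ, hga]) hw
  rw [Function.comp_apply, hφw, norm_div, le_div_iff₀ (norm_pos_iff.2 hne)] at h
  exact h

/-- Division of a bounded holomorphic function on the unit disc by a Blaschke factor. -/
theorem exists_eq_mul_of_eq_zero {g : ℂ → ℂ} (hg : DifferentiableOn ℂ g (Metric.ball 0 1))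
    (hg1 : ∀ z ∈ Metric.ball (0 : ℂ) 1, ‖g z‖ ≤ 1) {a : ℂ} (ha : ‖a‖ < 1) (hga : g a = 0) :
    ∃ G : ℂ → ℂ, DifferentiableOn ℂ G (Metric.ball 0 1) ∧
      (∀ z ∈ Metric.ball (0 : ℂ) 1, ‖G z‖ ≤ 1) ∧
      ∀ z, g z * (1 - (starRingEnd ℂ) a * z) = (z - a) * G z := by
  have ha' : Metric.ball (0 : ℂ) 1 ∈ nhds a :=
    Metric.isOpen_ball.mem_nhds (mem_ball_zero_iff.2 ha)
  have hfac : ∀ z, g z * (1 - (starRingEnd ℂ) a * z) =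
      (z - a) * (dslope g a z * (1 - (starRingEnd ℂ) a * z)) := by
    intro z
    have := sub_smul_dslope g a z
    rw [hga, sub_zero, smul_eq_mul] at this
    rw [← mul_assoc, this]
  have hd : DifferentiableOn ℂ (fun z => dslope g a z * (1 - (starRingEnd ℂ) a * z))
      (Metric.ball 0 1) :=
    ((Complex.differentiableOn_dslope ha').2 hg).mul (by fun_prop)
  have hne : ∀ z ∈ Metric.ball (0 : ℂ) 1, z ≠ a →
      ‖dslope g a z * (1 - (starRingEnd ℂ) a * z)‖ ≤ 1 := by
    intro z hz hza
    have h := norm_mul_le_norm_sub_of_eq_zero hg hg1 ha hga (mem_ball_zero_iff.1 hz)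
    rw [← norm_mul, hfac, norm_mul] at h
    have : 0 < ‖z - a‖ := norm_pos_iff.2 (sub_ne_zero.2 hza)
    nlinarith
  refine ⟨_, hd, fun z hz => ?_, hfac⟩
  by_cases hza : z = a
  · subst hza
    refine le_of_tendsto (f := fun w => ‖dslope g z w * (1 - (starRingEnd ℂ) z * w)‖)
      (x := nhdsWithin z {z}ᶜ) ?_ ?_
    · exact (((hd.continuousOn.continuousAt ha').tendsto).norm).mono_left nhdsWithin_le_nhds
    · filter_upwards [self_mem_nhdsWithin, nhdsWithin_le_nhds ha'] with w hw hw'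
      exact hne w hw' hw
  · exact hne z hz hza

/-! ### Removal of the zeros in the disc of radius `1/e`. -/

/-- A lower bound for a bounded holomorphic function on the unit disc by a monic polynomial
whose degree is controlled by the value at the origin. -/
theorem exists_monic_lower_bound (m : ℕ) : ∀ {g : ℂ → ℂ},
    DifferentiableOn ℂ g (Metric.ball 0 1) → (∀ z ∈ Metric.ball (0 : ℂ) 1, ‖g z‖ ≤ 1) →
    Real.exp (-m) ≤ ‖g 0‖ →
    ∃ P : Polynomial ℂ, P.Monic ∧ Real.exp P.natDegree * ‖g 0‖ ≤ 1 ∧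
      ∀ z : ℂ, 2 * ‖z‖ ≤ (Real.exp 1)⁻¹ →
        ‖g 0‖ ^ 3 * (4 / 5) ^ P.natDegree * ‖P.eval z‖ ≤ ‖g z‖ := by
  have he2 : (2 : ℝ) ≤ Real.exp 1 := by linarith [Real.add_one_le_exp (1 : ℝ)]
  have he : (Real.exp 1)⁻¹ ≤ 1 / 2 := by
    rw [one_div]; exact inv_anti₀ (by norm_num) he2
  have hepos : 0 < (Real.exp 1)⁻¹ := by positivity
  have base : ∀ {g : ℂ → ℂ}, DifferentiableOn ℂ g (Metric.ball 0 1) →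
      (∀ z ∈ Metric.ball (0 : ℂ) 1, ‖g z‖ ≤ 1) →
      (∀ z ∈ Metric.ball (0 : ℂ) (Real.exp 1)⁻¹, g z ≠ 0) →
      ∃ P : Polynomial ℂ, P.Monic ∧ Real.exp P.natDegree * ‖g 0‖ ≤ 1 ∧
      ∀ z : ℂ, 2 * ‖z‖ ≤ (Real.exp 1)⁻¹ →
        ‖g 0‖ ^ 3 * (4 / 5) ^ P.natDegree * ‖P.eval z‖ ≤ ‖g z‖ := by
    intro g hg hg1 h0
    have hsub : Metric.ball (0 : ℂ) (Real.exp 1)⁻¹ ⊆ Metric.ball 0 1 :=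
      Metric.ball_subset_ball (by linarith)
    refine ⟨1, Polynomial.monic_one, by simpa using hg1 0 (by simp), fun z hz => ?_⟩
    simpa using norm_pow_three_le_of_ne_zero hepos (hg.mono hsub)
      (fun z hz => hg1 z (hsub hz)) h0 hz
  have div : ∀ {g : ℂ → ℂ}, DifferentiableOn ℂ g (Metric.ball 0 1) →
      (∀ z ∈ Metric.ball (0 : ℂ) 1, ‖g z‖ ≤ 1) → 0 < ‖g 0‖ →
      ∀ a ∈ Metric.ball (0 : ℂ) (Real.exp 1)⁻¹, g a = 0 →
      ∃ G : ℂ → ℂ, DifferentiableOn ℂ G (Metric.ball 0 1) ∧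
        (∀ z ∈ Metric.ball (0 : ℂ) 1, ‖G z‖ ≤ 1) ∧ Real.exp 1 * ‖g 0‖ ≤ ‖G 0‖ ∧
        ∀ z : ℂ, 2 * ‖z‖ ≤ (Real.exp 1)⁻¹ → 4 / 5 * ‖z - a‖ * ‖G z‖ ≤ ‖g z‖ := by
    intro g hg hg1 hg0 a ha hga
    rw [mem_ball_zero_iff] at ha
    obtain ⟨G, hG, hG1, hGf⟩ := exists_eq_mul_of_eq_zero hg hg1 (ha.trans (by linarith)) hga
    refine ⟨G, hG, hG1, ?_, fun z hz => ?_⟩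
    · have h := congrArg norm (hGf 0)
      simp only [mul_zero, sub_zero, mul_one, zero_sub, norm_mul, norm_neg] at h
      rw [h, ← mul_assoc]
      have : Real.exp 1 * ‖a‖ ≤ 1 := by
        calc Real.exp 1 * ‖a‖ ≤ Real.exp 1 * (Real.exp 1)⁻¹ := by gcongr
          _ = 1 := mul_inv_cancel₀ (Real.exp_pos 1).ne'
      nlinarith [norm_nonneg (G 0)]
    · have h := congrArg norm (hGf z)
      rw [norm_mul, norm_mul] at h
      rw [mul_assoc, ← h]
      -- Here `‖a‖ < 1/2` and `‖z‖ ≤ 1/4`; this is the source of the factor `4 / 5` per zero.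
      have h1 : ‖1 - (starRingEnd ℂ) a * z‖ ≤ 5 / 4 := by
        refine (norm_sub_le _ _).trans ?_
        rw [norm_mul, RCLike.norm_conj, norm_one]
        nlinarith [norm_nonneg a, norm_nonneg z]
      nlinarith [norm_nonneg (g z)]
  induction m with
  | zero =>
    intro g hg hg1 hm
    refine base hg hg1 fun a ha hga => ?_
    have hg0 : 1 ≤ ‖g 0‖ := by simpa using hm
    obtain ⟨G, -, hG1, hG0, -⟩ := div hg hg1 (by linarith) a ha hga
    have := hG1 0 (by simp)
    nlinarith
  | succ m ih =>
    intro g hg hg1 hm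
    by_cases h0 : ∀ z ∈ Metric.ball (0 : ℂ) (Real.exp 1)⁻¹, g z ≠ 0
    · exact base hg hg1 h0
    push Not at h0
    obtain ⟨a, ha, hga⟩ := h0
    obtain ⟨G, hG, hG1, hG0, hGl⟩ := div hg hg1 ((Real.exp_pos _).trans_le hm) a ha hga
    obtain ⟨P, hP, hPd, hPl⟩ := ih hG hG1 (by
      refine le_trans ?_ hG0
      calc Real.exp (-(m : ℝ)) = Real.exp 1 * Real.exp (-((m + 1 : ℕ) : ℝ)) := by
            rw [← Real.exp_add]; push_cast; ring_nf
        _ ≤ _ := by gcongr)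
    have hdeg : ((Polynomial.X - Polynomial.C a) * P).natDegree = P.natDegree + 1 := by
      rw [(Polynomial.monic_X_sub_C a).natDegree_mul hP, Polynomial.natDegree_X_sub_C, add_comm]
    have hle : ‖g 0‖ ≤ ‖G 0‖ := by nlinarith [norm_nonneg (g 0)]
    refine ⟨(Polynomial.X - Polynomial.C a) * P, (Polynomial.monic_X_sub_C a).mul hP, ?_, ?_⟩
    · rw [hdeg]
      push_cast
      rw [Real.exp_add]
      have := Real.exp_pos P.natDegree
      nlinarith
    · intro z hz
      rw [hdeg, Polynomial.eval_mul, norm_mul]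
      simp only [Polynomial.eval_sub, Polynomial.eval_X, Polynomial.eval_C]
      calc ‖g 0‖ ^ 3 * (4 / 5) ^ (P.natDegree + 1) * (‖z - a‖ * ‖P.eval z‖)
          ≤ ‖G 0‖ ^ 3 * (4 / 5) ^ (P.natDegree + 1) * (‖z - a‖ * ‖P.eval z‖) := by gcongr
        _ = 4 / 5 * ‖z - a‖ * (‖G 0‖ ^ 3 * (4 / 5) ^ P.natDegree * ‖P.eval z‖) := by ring
        _ ≤ 4 / 5 * ‖z - a‖ * ‖G z‖ := by gcongr; exact hPl z hz
        _ ≤ ‖g z‖ := hGl z hz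

/-! ### Real sublevel sets of monic polynomials. -/

/-- Greedy choice: take a point of `E` almost at its infimum and discard everything up to distance
`s` beyond it. The strict excess of measure pays for the infimum not being attained. -/
theorem exists_separated_points {s : ℝ} (hs : 0 ≤ s) (k : ℕ) : ∀ {E : Set ℝ}, BddBelow E →
    ENNReal.ofReal (k * s) < volume E →
    ∃ x : ℕ → ℝ, (∀ i ≤ k, x i ∈ E) ∧ ∀ i < k, x i + s ≤ x (i + 1) := by
  induction k with
  | zero =>
    intro E _ hE
    obtain ⟨x, hx⟩ := nonempty_of_measure_ne_zero (ne_bot_of_gt hE)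
    exact ⟨fun _ => x, fun _ _ => hx, by simp⟩
  | succ k ih =>
    intro E hbdd hE
    have hne : E.Nonempty := nonempty_of_measure_ne_zero (ne_bot_of_gt hE)
    -- `volume E` may be infinite, so the excess is measured from a finite `q` below it.
    obtain ⟨q, hq1, hq2⟩ := exists_between hE
    have hqt : q ≠ ⊤ := hq2.ne_top
    have hlt : ((k + 1 : ℕ) : ℝ) * s < q.toReal := by
      rwa [ENNReal.ofReal_lt_iff_lt_toReal (by positivity) hqt] at hq1
    set ε := q.toReal - ((k + 1 : ℕ) : ℝ) * s with hε
    have hεpos : 0 < ε := by linarith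
    obtain ⟨x₀, hx₀, hx₀'⟩ := Real.lt_sInf_add_pos hne hεpos
    have hsub : E ⊆ Set.Icc (sInf E) (x₀ + s) ∪ (E ∩ Set.Ici (x₀ + s)) := by
      intro y hy
      by_cases h : y ≤ x₀ + s
      · exact Or.inl ⟨csInf_le hbdd hy, h⟩
      · exact Or.inr ⟨hy, (not_le.1 h).le⟩
    have hbig : ENNReal.ofReal (k * s) < volume (E ∩ Set.Ici (x₀ + s)) := by
      by_contra hcon
      rw [not_lt] at hcon
      have h1 : volume E ≤ ENNReal.ofReal (s + ε) + ENNReal.ofReal (k * s) := by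
        refine (measure_mono hsub).trans ((measure_union_le _ _).trans (add_le_add ?_ hcon))
        rw [Real.volume_Icc]
        exact ENNReal.ofReal_le_ofReal (by linarith)
      rw [← ENNReal.ofReal_add (by positivity) (by positivity)] at h1
      have h2 : s + ε + k * s = q.toReal := by rw [hε]; push_cast; ring
      rw [h2, ENNReal.ofReal_toReal hqt] at h1
      exact absurd hq2 (not_lt.2 h1)
    obtain ⟨x, hx, hxs⟩ := ih (hbdd.mono Set.inter_subset_left) hbig
    refine ⟨fun i => Nat.casesOn i x₀ x, ?_, ?_⟩
    · rintro (_ | i) hi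
      · exact hx₀
      · exact (hx i (by omega)).1
    · rintro (_ | i) hi
      · exact (hx 0 (by omega)).2
      · exact hxs i (by omega)

theorem mul_le_sub_of_separated {x : ℕ → ℝ} {s : ℝ} {k : ℕ}
    (hx : ∀ i < k, x i + s ≤ x (i + 1)) {i j : ℕ} (hij : i ≤ j) (hj : j ≤ k) :
    ((j : ℝ) - i) * s ≤ x j - x i := by
  induction j, hij using Nat.le_induction with
  | base => simp
  | succ j hij ih =>
    have h1 := ih (by omega)
    have h2 := hx j (by omega)
    push_cast
    linarith

theorem prod_erase_abs_sub (N i : ℕ) (hi : i ≤ N) :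
    ∏ j ∈ (Finset.range (N + 1)).erase i, |(i : ℝ) - j| = (i.factorial * (N - i).factorial : ℕ) := by
  have hsplit : (Finset.range (N + 1)).erase i =
      Finset.range i ∪ Finset.Ico (i + 1) (N + 1) := by
    ext j
    simp only [Finset.mem_erase, Finset.mem_range, Finset.mem_union, Finset.mem_Ico]
    omega
  have hdisj : Disjoint (Finset.range i) (Finset.Ico (i + 1) (N + 1)) := by
    rw [Finset.disjoint_left]
    intro j
    simp only [Finset.mem_range, Finset.mem_Ico]
    omega
  rw [hsplit, Finset.prod_union hdisj, Nat.cast_mul]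
  congr 1
  · rw [← Finset.prod_range_add_one_eq_factorial, ← Finset.prod_range_reflect, Nat.cast_prod]
    refine Finset.prod_congr rfl fun j hj => ?_
    have hj := Finset.mem_range.1 hj
    have hij : i = (i - 1 - j) + (j + 1) := by omega
    have hc : (i : ℝ) = ((i - 1 - j : ℕ) : ℝ) + ((j + 1 : ℕ) : ℝ) := by
      rw [← Nat.cast_add, ← hij]
    rw [hc, add_sub_cancel_left, Nat.abs_cast]
  · rw [Finset.prod_Ico_eq_prod_range, ← Finset.prod_range_add_one_eq_factorial, Nat.cast_prod,
      show N + 1 - (i + 1) = N - i by omega]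
    refine Finset.prod_congr rfl fun j _ => ?_
    rw [abs_of_nonpos (by push_cast; linarith)]
    push_cast
    ring

/-- The real sublevel set of a monic complex polynomial of degree `N` at height `h ^ N` has measure
at most `2 * e * h`. -/
theorem volume_le_of_norm_eval_lt {P : Polynomial ℂ} (hP : P.Monic) {h : ℝ} (hh : 0 < h)
    {E : Set ℝ} (hE : BddBelow E) (hPE : ∀ x ∈ E, ‖P.eval (x : ℂ)‖ < h ^ P.natDegree) :
    volume E ≤ ENNReal.ofReal (2 * Real.exp 1 * h) := by
  by_contra hcon
  rw [not_le] at hcon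
  set N := P.natDegree with hN
  rcases Nat.eq_zero_or_pos N with h0 | hNpos
  · obtain ⟨x, hx⟩ := nonempty_of_measure_ne_zero (ne_bot_of_gt hcon)
    have := hPE x hx
    rw [Polynomial.eq_one_of_monic_natDegree_zero hP (hN ▸ h0), h0] at this
    simp at this
  have hNr : (0 : ℝ) < N := by exact_mod_cast hNpos
  set s := 2 * Real.exp 1 * h / N with hs
  have hspos : 0 < s := by positivity
  have hNs : (N : ℝ) * s = 2 * Real.exp 1 * h := by rw [hs]; field_simp
  obtain ⟨x, hxE, hxs⟩ := exists_separated_points hspos.le N hE (hNs ▸ hcon)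
  have hdist : ∀ i ≤ N, ∀ j ≤ N, |(i : ℝ) - j| * s ≤ |x i - x j| := by
    intro i hi j hj
    rcases le_total i j with hij | hij
    · have hc : (i : ℝ) ≤ j := by exact_mod_cast hij
      rw [abs_sub_comm, abs_sub_comm (x i), abs_of_nonneg (by linarith)]
      exact (mul_le_sub_of_separated hxs hij hj).trans (le_abs_self _)
    · have hc : (j : ℝ) ≤ i := by exact_mod_cast hij
      rw [abs_of_nonneg (by linarith)]
      exact (mul_le_sub_of_separated hxs hij hi).trans (le_abs_self _)
  have hinj : Set.InjOn (fun i => ((x i : ℝ) : ℂ)) (Finset.range (N + 1)) := by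
    intro i hi j hj hij
    by_contra hne
    have hij' : x i = x j := Complex.ofReal_injective hij
    have h1 := hdist i (by simpa [Nat.lt_succ_iff] using hi) j (by simpa [Nat.lt_succ_iff] using hj)
    rw [hij', sub_self, abs_zero] at h1
    have h2 : (0 : ℝ) < |(i : ℝ) - j| := abs_pos.2 (sub_ne_zero.2 (by exact_mod_cast hne))
    nlinarith
  -- The leading coefficient `1` is a sum of quotients `P (x i) / ∏ (x i - x j)`. The gaps make each
  -- denominator at least `i! * (N - i)! * s ^ N`, so the sum is below `(N / e) ^ N / N! ≤ 1`, a
  -- contradiction.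
  have hlead := Lagrange.leadingCoeff_eq_sum (s := Finset.range (N + 1))
    (v := fun i => ((x i : ℝ) : ℂ)) hinj (P := P) (by
      rw [Finset.card_range, Polynomial.degree_eq_natDegree hP.ne_zero]; norm_cast)
  rw [hP.leadingCoeff] at hlead
  have hprod : ∀ i ≤ N, ((i.factorial * (N - i).factorial : ℕ) : ℝ) * s ^ N ≤
      ‖∏ j ∈ (Finset.range (N + 1)).erase i, (((x i : ℝ) : ℂ) - ((x j : ℝ) : ℂ))‖ := by
    intro i hi
    have hi' : i ∈ Finset.range (N + 1) := Finset.mem_range.2 (by omega)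
    have hcard : ((Finset.range (N + 1)).erase i).card = N := by
      rw [Finset.card_erase_of_mem hi', Finset.card_range]; rfl
    rw [← prod_erase_abs_sub N i hi, norm_prod]
    have hconst : ∏ _j ∈ (Finset.range (N + 1)).erase i, s = s ^ N := by
      rw [Finset.prod_const, hcard]
    rw [← hconst, ← Finset.prod_mul_distrib]
    refine Finset.prod_le_prod (fun _ _ => by positivity) fun j hj => ?_
    rw [← Complex.ofReal_sub, Complex.norm_real, Real.norm_eq_abs]
    exact hdist i hi j (by
      have := Finset.mem_range.1 (Finset.mem_of_mem_erase hj); omega)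
  have hterm : ∀ i ∈ Finset.range (N + 1),
      ‖P.eval ((x i : ℝ) : ℂ) /
        ∏ j ∈ (Finset.range (N + 1)).erase i, (((x i : ℝ) : ℂ) - ((x j : ℝ) : ℂ))‖ <
      (N.choose i : ℝ) * (h ^ N / (s ^ N * N.factorial)) := by
    intro i hi
    have hi : i ≤ N := by have := Finset.mem_range.1 hi; omega
    have hchoose : (N.choose i : ℝ) * (i.factorial * (N - i).factorial : ℕ) = N.factorial := by
      rw [← Nat.cast_mul, ← mul_assoc, Nat.choose_mul_factorial_mul_factorial hi]
    have hfac : (0 : ℝ) < (i.factorial * (N - i).factorial : ℕ) := by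
      exact_mod_cast Nat.mul_pos (Nat.factorial_pos _) (Nat.factorial_pos _)
    have hNf : (0 : ℝ) < N.factorial := by exact_mod_cast N.factorial_pos
    have hA := hprod i hi
    have hpos : 0 < ((i.factorial * (N - i).factorial : ℕ) : ℝ) * s ^ N := by positivity
    calc _ < h ^ N / (((i.factorial * (N - i).factorial : ℕ) : ℝ) * s ^ N) := by
          rw [norm_div]
          exact div_lt_div₀ (hPE _ (hxE i hi)) hA (by positivity) hpos
      _ = _ := by
          rw [← hchoose]
          have : (0 : ℝ) < N.choose i := by exact_mod_cast Nat.choose_pos hi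
          field_simp
  have hsum : (1 : ℝ) < 2 ^ N * (h ^ N / (s ^ N * N.factorial)) := by
    calc (1 : ℝ) = ‖(1 : ℂ)‖ := by simp
      _ ≤ _ := by rw [hlead]; exact norm_sum_le _ _
      _ < _ := Finset.sum_lt_sum_of_nonempty ⟨0, by simp⟩ hterm
      _ = _ := by rw [← Finset.sum_mul]; congr 1; exact_mod_cast Nat.sum_range_choose N
  have hNf : (0 : ℝ) < N.factorial := by exact_mod_cast N.factorial_pos
  have hexp := Real.pow_div_factorial_le_exp (x := N) hNr.le N
  have hval : (2 : ℝ) ^ N * (h ^ N / (s ^ N * N.factorial)) =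
      (N : ℝ) ^ N / N.factorial / Real.exp N := by
    rw [hs, div_pow, mul_pow, mul_pow, ← Real.exp_nat_mul, mul_one]
    field_simp
  rw [hval, lt_div_iff₀ (Real.exp_pos _)] at hsum
  linarith

/-! ### The estimate on one ray. -/

theorem volume_sublevel_unit_disc_le {g : ℂ → ℂ} (hg : DifferentiableOn ℂ g (Metric.ball 0 1))
    (hg1 : ∀ z ∈ Metric.ball (0 : ℂ) 1, ‖g z‖ ≤ 1) {δ β : ℝ} (hδ : 0 < δ) (hδg : δ ≤ ‖g 0‖)
    (hβ : 0 < β) :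
    volume {t : ℝ | (0 < t ∧ t < (2 * Real.exp 1)⁻¹) ∧
      ‖g t‖ < δ * (β / (30 * Real.exp 1 ^ 3)) ^ Real.log (1 / δ)} ≤
      ENNReal.ofReal (β / (4 * Real.exp 1)) := by
  have hepos := Real.exp_pos 1
  have he2 : (2 : ℝ) ≤ Real.exp 1 := by linarith [Real.add_one_le_exp (1 : ℝ)]
  have he3 : Real.exp 1 ≤ 3 := by linarith [Real.exp_one_lt_d9]
  set c := β / (30 * Real.exp 1 ^ 3) with hc
  have hcpos : 0 < c := by positivity
  have hβc : β = 30 * Real.exp 1 ^ 3 * c := by rw [hc]; field_simp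
  -- For `c ≥ exp (-2)` the claimed bound exceeds the length of the whole interval; otherwise `log c
  -- ≤ -2`, which the comparison of constants needs.
  rcases le_or_gt (Real.exp (-2)) c with hbig | hsmall
  · refine (measure_mono fun t ht => ht.1 :
      _ ≤ volume (Set.Ioo (0 : ℝ) (2 * Real.exp 1)⁻¹)).trans ?_
    rw [Real.volume_Ioo, sub_zero]
    refine ENNReal.ofReal_le_ofReal ?_
    have h1 : Real.exp 1 ^ 2 * Real.exp (-2) = 1 := by
      rw [← Real.exp_nat_mul, ← Real.exp_add]; norm_num
    have h2 : 2 ≤ β := by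
      rw [hβc]
      calc (2 : ℝ) ≤ 30 * Real.exp 1 * (Real.exp 1 ^ 2 * Real.exp (-2)) := by rw [h1]; linarith
        _ = 30 * Real.exp 1 ^ 3 * Real.exp (-2) := by ring
        _ ≤ _ := by gcongr
    rw [inv_eq_one_div, div_le_div_iff₀ (by positivity) (by positivity)]
    nlinarith
  have hg0 : 0 < ‖g 0‖ := hδ.trans_le hδg
  obtain ⟨m, hm⟩ := exists_nat_ge (-Real.log ‖g 0‖)
  obtain ⟨P, hP, hPd, hPl⟩ := exists_monic_lower_bound m hg hg1 (by
    rw [← Real.le_log_iff_exp_le hg0]; linarith)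
  set N := P.natDegree with hN
  have hNlog : (N : ℝ) ≤ -Real.log ‖g 0‖ := by
    have := Real.log_le_log (by positivity) hPd
    rw [Real.log_mul (Real.exp_pos _).ne' hg0.ne', Real.log_exp, Real.log_one] at this
    linarith
  have hδlog : Real.log δ ≤ Real.log ‖g 0‖ := Real.log_le_log hδ hδg
  have hcl : Real.log c ≤ -2 := by
    rw [← Real.log_exp (-2)]; exact Real.log_le_log hcpos hsmall.le
  -- With `L = -log δ` and `l = -log ‖g 0‖`, the logarithms differ by `(L - N) * (-log c) + L - 3 *
  -- l + 2 * N ≥ 3 * (L - l) ≥ 0`. The factor `e ^ 2` is what absorbs the cube.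
  have hconst : δ * c ^ Real.log (1 / δ) ≤ ‖g 0‖ ^ 3 * (Real.exp 1 ^ 2 * c) ^ N := by
    rw [← Real.log_le_log_iff (by positivity) (by positivity),
      Real.log_mul hδ.ne' (by positivity), Real.log_rpow hcpos,
      Real.log_mul (by positivity) (by positivity), Real.log_pow, Real.log_pow,
      Real.log_mul (by positivity) hcpos.ne', Real.log_pow, Real.log_exp, one_div, Real.log_inv]
    push_cast
    nlinarith [mul_nonneg (by linarith : 0 ≤ -Real.log δ - N) (by linarith : 0 ≤ -2 - Real.log c)]
  have hvol := volume_le_of_norm_eval_lt hP (h := 5 / 4 * (Real.exp 1 ^ 2 * c)) (by positivity)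
    (E := {t : ℝ | (0 < t ∧ t < (2 * Real.exp 1)⁻¹) ∧ ‖g t‖ < δ * c ^ Real.log (1 / δ)})
    ⟨0, fun t ht => ht.1.1.le⟩ (by
      rintro t ⟨⟨ht0, ht1⟩, htg⟩
      have h1 := hPl t (by
        rw [Complex.norm_real, Real.norm_of_nonneg ht0.le]
        calc 2 * t ≤ 2 * (2 * Real.exp 1)⁻¹ := by gcongr
          _ = _ := by field_simp)
      have h2 := h1.trans_lt (htg.trans_le hconst)
      rw [mul_assoc] at h2
      have h3 := lt_of_mul_lt_mul_left h2 (by positivity)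
      rw [mul_pow, ← hN]
      calc ‖P.eval (t : ℂ)‖ = (5 / 4) ^ N * ((4 / 5) ^ N * ‖P.eval (t : ℂ)‖) := by
            rw [← mul_assoc, ← mul_pow]; norm_num
        _ < _ := by gcongr)
  refine hvol.trans (ENNReal.ofReal_le_ofReal ?_)
  -- The constant `30` comes from here: the requirement is `10 * e ^ 4 * c ≤ 30 * e ^ 3 * c`, that
  -- is `e ≤ 3`.
  rw [hβc, le_div_iff₀ (by positivity)]
  have : 0 < Real.exp 1 ^ 3 * c := by positivity
  nlinarith

/-! ### From rays to the ball, and the union over `k`. -/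

/-- Measure of a subset of a ball from a uniform bound on its intersections with rays. -/
theorem volume_le_of_forall_ray {n : ℕ} (hn : 0 < n) {ρ : ℝ}
    {A : Set (EuclideanSpace ℝ (Fin n))} (hA : MeasurableSet A) (hAρ : A ⊆ Metric.ball 0 ρ)
    {C : ENNReal} (hC : ∀ θ : EuclideanSpace ℝ (Fin n), ‖θ‖ = 1 →
      volume {t : ℝ | 0 < t ∧ t • θ ∈ A} ≤ C) :
    volume A ≤ (volume : Measure (EuclideanSpace ℝ (Fin n))).toSphere Set.univ *
      (ENNReal.ofReal (ρ ^ (n - 1)) * C) := by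
  have : Nonempty (Fin n) := ⟨⟨0, hn⟩⟩
  have : Nontrivial (EuclideanSpace ℝ (Fin n)) := inferInstance
  set μ : Measure (EuclideanSpace ℝ (Fin n)) := volume with hμ
  have hmp := (μ.measurePreserving_homeomorphUnitSphereProd).symm
    (homeomorphUnitSphereProd (EuclideanSpace ℝ (Fin n))).toMeasurableEquiv
  have hemb : MeasurableEmbedding
      (Subtype.val : ({0}ᶜ : Set (EuclideanSpace ℝ (Fin n))) → EuclideanSpace ℝ (Fin n)) :=
    MeasurableEmbedding.subtype_coe (measurableSet_singleton _).compl
  have hA' : MeasurableSet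
      (Subtype.val ⁻¹' A : Set ({0}ᶜ : Set (EuclideanSpace ℝ (Fin n)))) := hemb.measurable hA
  have h1 : μ A = (μ.comap (Subtype.val :
      ({0}ᶜ : Set (EuclideanSpace ℝ (Fin n))) → EuclideanSpace ℝ (Fin n))) (Subtype.val ⁻¹' A) := by
    rw [hemb.comap_apply, Subtype.image_preimage_coe, ← Set.sdiff_eq_compl_inter,
      measure_sdiff_null (measure_singleton _)]
  rw [h1, ← hmp.measure_preimage hA'.nullMeasurableSet,
    Measure.prod_apply (hmp.measurable hA'), mul_comm, ← lintegral_const]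
  refine lintegral_mono fun θ => ?_
  have hθ : ‖(θ : EuclideanSpace ℝ (Fin n))‖ = 1 := by simp
  set S : Set (Set.Ioi (0 : ℝ)) := {t | (t : ℝ) • (θ : EuclideanSpace ℝ (Fin n)) ∈ A} with hS
  have hSm : MeasurableSet S :=
    (by fun_prop : Measurable fun t : Set.Ioi (0 : ℝ) =>
      (t : ℝ) • (θ : EuclideanSpace ℝ (Fin n))) hA
  have hfin : Module.finrank ℝ (EuclideanSpace ℝ (Fin n)) = n := by simp
  change Measure.volumeIoiPow (Module.finrank ℝ (EuclideanSpace ℝ (Fin n)) - 1) S ≤ _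
  rw [hfin, Measure.volumeIoiPow, withDensity_apply _ hSm]
  have hSle : ∀ t ∈ S, ENNReal.ofReal ((t : ℝ) ^ (n - 1)) ≤ ENNReal.ofReal (ρ ^ (n - 1)) := by
    intro t ht
    have ht0 : (0 : ℝ) < t := t.2
    have h2 := mem_ball_zero_iff.1 (hAρ ht)
    rw [norm_smul, hθ, mul_one, Real.norm_of_nonneg ht0.le] at h2
    exact ENNReal.ofReal_le_ofReal (pow_le_pow_left₀ ht0.le h2.le _)
  refine (setLIntegral_mono measurable_const hSle).trans ?_
  rw [setLIntegral_const]
  refine mul_le_mul_right ?_ _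
  rw [(MeasurableEmbedding.subtype_coe measurableSet_Ioi).comap_apply]
  refine (measure_mono ?_).trans (hC θ hθ)
  rintro _ ⟨t, ht, rfl⟩
  exact ⟨t.2, ht⟩

theorem norm_realToComplex {n : ℕ} (y : EuclideanSpace ℝ (Fin n)) : ‖realToComplex y‖ = ‖y‖ := by
  simp [realToComplex, EuclideanSpace.norm_eq]

theorem realToComplex_smul {n : ℕ} (t : ℝ) (y : EuclideanSpace ℝ (Fin n)) :
    realToComplex (t • y) = (t : ℂ) • realToComplex y := by
  ext i; simp [realToComplex]

theorem continuous_realToComplex {n : ℕ} :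
    Continuous (realToComplex : EuclideanSpace ℝ (Fin n) → EuclideanSpace ℂ (Fin n)) := by
  unfold realToComplex
  fun_prop

theorem volume_sublevel_ball_le {n : ℕ} (hn : 0 < n) {r : ℝ} (hr : 0 < r)
    {f : EuclideanSpace ℂ (Fin n) → ℂ} (hf : DifferentiableOn ℂ f (Metric.ball 0 r))
    (hf1 : ∀ z ∈ Metric.ball (0 : EuclideanSpace ℂ (Fin n)) r, ‖f z‖ ≤ 1) {δ β : ℝ}
    (hδ : 0 < δ) (hf0 : δ ≤ ‖f 0‖) (hβ : 0 < β) :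
    volume {y : EuclideanSpace ℝ (Fin n) | ‖y‖ < r / (2 * Real.exp 1) ∧
        ‖f (realToComplex y)‖ < δ * (β / (30 * Real.exp 1 ^ 3)) ^ Real.log (1 / δ)} ≤
      sphereArea n * ENNReal.ofReal (1 / 2 * (r / (2 * Real.exp 1)) ^ n * β) := by
  have he2 : (2 : ℝ) ≤ Real.exp 1 := by linarith [Real.add_one_le_exp (1 : ℝ)]
  set ρ := r / (2 * Real.exp 1) with hρ
  have hρpos : 0 < ρ := by positivity
  have hρr : ρ ≤ r := div_le_self hr.le (by linarith)
  set κ := δ * (β / (30 * Real.exp 1 ^ 3)) ^ Real.log (1 / δ) with hκ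
  have hopen : IsOpen {y : EuclideanSpace ℝ (Fin n) | ‖y‖ < ρ ∧ ‖f (realToComplex y)‖ < κ} := by
    have hcont : ContinuousOn (fun y : EuclideanSpace ℝ (Fin n) => ‖f (realToComplex y)‖)
        (Metric.ball 0 ρ) := by
      refine (hf.continuousOn.comp continuous_realToComplex.continuousOn fun y hy => ?_).norm
      rw [mem_ball_zero_iff] at hy ⊢
      rw [norm_realToComplex]
      exact hy.trans_le hρr
    have := hcont.isOpen_inter_preimage Metric.isOpen_ball (isOpen_Iio (a := κ))
    convert this using 1
    ext y
    simp
  refine (volume_le_of_forall_ray hn hopen.measurableSet (ρ := ρ)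
    (C := ENNReal.ofReal (1 / 2 * ρ * β)) (fun y hy => mem_ball_zero_iff.2 hy.1)
    fun θ hθ => ?_).trans ?_
  · have hmaps : Set.MapsTo (fun z : ℂ => (z * (r : ℂ)) • realToComplex θ) (Metric.ball 0 1)
        (Metric.ball 0 r) := by
      intro z hz
      rw [mem_ball_zero_iff] at hz ⊢
      rw [norm_smul, norm_mul, norm_realToComplex, hθ, Complex.norm_real,
        Real.norm_of_nonneg hr.le]
      nlinarith
    have h := volume_sublevel_unit_disc_le (g := fun z => f ((z * (r : ℂ)) • realToComplex θ))
      (hf.comp (by fun_prop) hmaps) (fun z hz => hf1 _ (hmaps hz)) hδ (by simpa using hf0) hβ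
    rw [← hκ] at h
    have hset : {t : ℝ | 0 < t ∧ t • θ ∈
        {y : EuclideanSpace ℝ (Fin n) | ‖y‖ < ρ ∧ ‖f (realToComplex y)‖ < κ}} ⊆
        (fun t => r⁻¹ * t) ⁻¹' {t : ℝ | (0 < t ∧ t < (2 * Real.exp 1)⁻¹) ∧
          ‖f (((t : ℂ) * (r : ℂ)) • realToComplex θ)‖ < κ} := by
      rintro t ⟨ht, ht1, ht2⟩
      rw [norm_smul, hθ, mul_one, Real.norm_of_nonneg ht.le] at ht1
      refine ⟨⟨by positivity, ?_⟩, ?_⟩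
      · calc r⁻¹ * t < r⁻¹ * ρ := by gcongr
          _ = _ := by rw [hρ]; field_simp
      · rw [realToComplex_smul] at ht2
        have hrc : (r : ℂ) ≠ 0 := by exact_mod_cast hr.ne'
        have : ((r⁻¹ * t : ℝ) : ℂ) * (r : ℂ) = t := by push_cast; field_simp
        rwa [this]
    -- Rescaling by `r` turns `β / (4 * e)` into `1 / 2 * ρ * β`.
    refine (measure_mono hset).trans ?_
    rw [Real.volume_preimage_mul_left (inv_ne_zero hr.ne'), inv_inv, abs_of_pos hr]
    refine (mul_le_mul_right h _).trans ?_
    rw [← ENNReal.ofReal_mul hr.le]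
    refine ENNReal.ofReal_le_ofReal (le_of_eq ?_)
    rw [hρ]
    field_simp
    norm_num
  · rw [← ENNReal.ofReal_mul (by positivity), sphereArea]
    refine mul_le_mul_right (ENNReal.ofReal_le_ofReal (le_of_eq ?_)) _
    obtain ⟨m, rfl⟩ := Nat.exists_eq_succ_of_ne_zero hn.ne'
    rw [Nat.succ_sub_one, pow_succ]
    ring

theorem proposition6p1 (n : ℕ) (r μ : ℝ) (hr : 0 < r) (hμ : 0 < μ)
    (Z : Set (Fin n → ℤ)) (hZ : Z ⊆ {k | k ≠ 0})
    (b : (Fin n → ℤ) → ℝ) (hb : ∀ k ∈ Z, 0 < b k)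
    (f : (Fin n → ℤ) → EuclideanSpace ℂ (Fin n) → ℂ)
    (δ : (Fin n → ℤ) → ℝ)
    (hf : ∀ k ∈ Z, DifferentiableOn ℂ (f k) (Metric.ball 0 r))
    (hf1 : ∀ k ∈ Z, ∀ z ∈ Metric.ball (0 : EuclideanSpace ℂ (Fin n)) r, ‖f k z‖ ≤ 1)
    (hδ : ∀ k ∈ Z, 0 < δ k)
    (hf0 : ∀ k ∈ Z, δ k ≤ ‖f k 0‖) :
    volume {y : EuclideanSpace ℝ (Fin n) | ‖y‖ < r / (2 * Real.exp 1) ∧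
        ¬ ∀ k ∈ Z, δ k * (μ * b k / (30 * Real.exp 1 ^ 3)) ^ Real.log (1 / δ k)
            ≤ ‖f k (realToComplex y)‖}
      ≤ ENNReal.ofReal (1 / 2) * sphereArea n * weightSum b Z *
          ENNReal.ofReal ((r / (2 * Real.exp 1)) ^ n) * ENNReal.ofReal μ := by
  have hsub : {y : EuclideanSpace ℝ (Fin n) | ‖y‖ < r / (2 * Real.exp 1) ∧
        ¬ ∀ k ∈ Z, δ k * (μ * b k / (30 * Real.exp 1 ^ 3)) ^ Real.log (1 / δ k)
            ≤ ‖f k (realToComplex y)‖} ⊆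
      ⋃ k : Z, {y | ‖y‖ < r / (2 * Real.exp 1) ∧ ‖f k (realToComplex y)‖ <
        δ k * (μ * b k / (30 * Real.exp 1 ^ 3)) ^ Real.log (1 / δ k)} := by
    rintro y ⟨hy, hk⟩
    push Not at hk
    obtain ⟨k, hkZ, hk⟩ := hk
    exact Set.mem_iUnion.2 ⟨⟨k, hkZ⟩, hy, hk⟩
  refine (measure_mono hsub).trans ((measure_iUnion_le _).trans ?_)
  have hterm : ∀ k : Z, volume {y : EuclideanSpace ℝ (Fin n) | ‖y‖ < r / (2 * Real.exp 1) ∧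
      ‖f k (realToComplex y)‖ <
        δ k * (μ * b k / (30 * Real.exp 1 ^ 3)) ^ Real.log (1 / δ k)} ≤
      (ENNReal.ofReal (1 / 2) * sphereArea n * ENNReal.ofReal ((r / (2 * Real.exp 1)) ^ n) *
        ENNReal.ofReal μ) * ENNReal.ofReal (b k) := by
    rintro ⟨k, hk⟩
    -- For `n = 0` the only index is `0`, which `Z` excludes.
    have hn : 0 < n := by
      rcases Nat.eq_zero_or_pos n with rfl | hn
      · exact absurd (Subsingleton.elim k 0) (hZ hk)
      · exact hn
    refine (volume_sublevel_ball_le hn hr (hf k hk) (hf1 k hk) (hδ k hk) (hf0 k hk)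
      (mul_pos hμ (hb k hk))).trans (le_of_eq ?_)
    rw [ENNReal.ofReal_mul (by positivity), ENNReal.ofReal_mul (by positivity),
      ENNReal.ofReal_mul hμ.le]
    ring
  refine (ENNReal.tsum_le_tsum hterm).trans (le_of_eq ?_)
  rw [ENNReal.tsum_mul_left, weightSum]
  ring
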